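/- Let $r>0$, $\alpha>2$, and let $g:\mathbb{N}\times(0,\infty)\to(0,\infty)$ (where $0\in\mathbb{N}$) satisfy $$|g(y,\lambda)-g(y^*,\lambda^*)|\le c_1|y-y^*|+c_2|\lambda-\lambda^*|\qquad\text{for all } y,y^*\in\mathbb{N},\ \lambda,\lambda^*>0,$$ with constants $c_1,c_2\ge 0$ such that $$\frac{(r+1)(\alpha-1)}{r(\alpha-2)}\,c_1^2+c_2^2+2c_1c_2<1.$$ For $\lambda>0$ let $\mathcal{BNB}(\lambda,r,\alpha)$ denote the beta negative binomial distribution on $\mathbb{N}$ with mean $\lambda$, whose probability mass function is $$k\mapsto \frac{\Gamma(k+r)}{\Gamma(k+1)\Gamma(r)}\,\frac{B\big(\alpha+r,(\alpha-1)\lambda/r+k\big)}{B\big(\alpha,(\alpha-1)\lambda/r\big)},\qquad k\in\mathbb{N},$$ where $\Gamma$ and $B$ are the gamma and beta functions. Let $\{(y_t,\lambda_t)\}_{t\in\mathbb{Z}}$, with $y_t\in\mathbb{N}$ and $\lambda_t>0$, be a strictly stationary solution of the BNB autoregression $$y_t\mid\mathcal{F}_{t-1}\sim\mathcal{BNB}(\lambda_t,r,\alpha),\qquad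 \lambda_{t+1}=g(y_t,\lambda_t),\qquad t\in\mathbb{Z},$$ where $\mathcal{F}_t$ is the $\sigma$-field generated by $y_t,y_{t-1},\dots$ and $\lambda_t$ is $\mathcal{F}_{t-1}$-measurable. Then $\mathbb{E}(y_t^2)<\infty$ for every $t\in\mathbb{Z}$. Hence $\{y_t\}_{t\in\mathbb{Z}}$ is weakly stationary: it is square integrable, its mean is constant in $t$, and $\operatorname{Cov}(y_{s+h},y_{t+h})=\operatorname{Cov}(y_s,y_t)$ for all $s,t,h\in\mathbb{Z}$. -/

import Mathlib

open MeasureTheory ProbabilityTheory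

noncomputable section

/-- Probability mass function of the beta negative binomial distribution with mean `lam > 0`,
dispersion parameter `r > 0` and tail parameter `α > 1`:
`Γ(k + r) / (Γ(k + 1) Γ(r)) * B(α + r, (α - 1) lam / r + k) / B(α, (α - 1) lam / r)`. -/
def bnbPMFReal (lam r α : ℝ) (k : ℕ) : ℝ :=
  Real.Gamma (k + r) / (Real.Gamma (k + 1) * Real.Gamma r) *
    (ProbabilityTheory.beta (α + r) ((α - 1) * lam / r + k) /
      ProbabilityTheory.beta α ((α - 1) * lam / r))

/-- The `σ`-field `𝓕 t` generated by `y t, y (t - 1), y (t - 2), …`. -/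
@[reducible] def pastSigma {Ω : Type*} (y : ℤ → Ω → ℕ) (t : ℤ) : MeasurableSpace Ω :=
  ⨆ s : Set.Iic t, MeasurableSpace.comap (y s) ⊤

/-- `(y, lam)` solves the equations of the beta negative binomial autoregression with updating
function `g` (used on `ℕ × (0, ∞)` only): given the past `𝓕 (t - 1)`, the count `y t` has the
beta negative binomial law with mean `lam t`, dispersion `r` and tail parameter `α`; the process
`lam` is positive and `𝓕 (t - 1)`-measurable (up to null sets) at time `t`; and
`lam (t + 1) = g (y t) (lam t)` almost surely. -/
structure IsBNBAutoregression {Ω : Type*} [MeasurableSpace Ω] (μ : Measure Ω) (r α : ℝ)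
    (g : ℕ → ℝ → ℝ) (y : ℤ → Ω → ℕ) (lam : ℤ → Ω → ℝ) : Prop where
  measurable_count : ∀ t, Measurable (y t)
  predictable : ∀ t, AEStronglyMeasurable[pastSigma y (t - 1)] (lam t) μ
  pos : ∀ t, ∀ᵐ ω ∂μ, 0 < lam t ω
  condLaw : ∀ (t : ℤ) (k : ℕ),
    μ[(y t ⁻¹' {k}).indicator (fun _ => (1 : ℝ)) | pastSigma y (t - 1)]
      =ᵐ[μ] fun ω => bnbPMFReal (lam t ω) r α k
  recursion : ∀ t, ∀ᵐ ω ∂μ, lam (t + 1) ω = g (y t ω) (lam t ω)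

/-- Strict stationarity: the law of the whole path is invariant under time shifts. -/
def IsStrictlyStationary {Ω S : Type*} [MeasurableSpace Ω] [MeasurableSpace S]
    (μ : Measure Ω) (X : ℤ → Ω → S) : Prop :=
  ∀ h : ℤ, IdentDistrib (fun ω (t : ℤ) => X (t + h) ω) (fun ω (t : ℤ) => X t ω) μ μ

/-- Weak stationarity: square integrable, with constant mean and shift-invariant
autocovariances. -/
structure IsWeaklyStationary {Ω : Type*} [MeasurableSpace Ω]
    (μ : Measure Ω) (X : ℤ → Ω → ℝ) : Prop where
  memLp : ∀ t, MemLp (X t) 2 μ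
  mean_eq : ∀ s t, ∫ ω, X s ω ∂μ = ∫ ω, X t ω ∂μ
  cov_eq : ∀ s t h, covariance (X (s + h)) (X (t + h)) μ = covariance (X s) (X t) μ

end

/-!
The proof is a Foster–Lyapunov drift argument for the stationary intensity with `V(x) = x ^ 2`.

The beta negative binomial law is a beta mixture of negative binomial laws, so its total mass is at
most one (`sum_betaNegBin_le_one`), and size biasing shifts its parameters
(`succ_mul_betaNegBin_succ`); together these bound the first two factorial moments, which is where
`α > 2` enters. Upper bounds suffice throughout. By the Lipschitz condition,
`lam (t + 1) ≤ c₁ * y t + c₂ * lam t + K`, and the conditional second moment of the right side given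
the past is at most `κ * lam t ^ 2 + O(lam t + 1)`, where `κ < 1` is the constant of the contraction
hypothesis.

The second moment of `lam t` is not known to be finite beforehand, so expectations cannot be taken
in this inequality directly. Both sides are truncated at a level `M`, which preserves the
conditional bound (`IsBNBAutoregression.lintegral_min_le`), and stationarity gives
`E[V ∧ M] ≤ E[(κ' * V + C) ∧ M]` with `κ' < 1`. The pointwise inequality
`(1 - κ') * V * 1{V ≤ M} + (κ' * V + C) ∧ M ≤ V ∧ M + C` then bounds `E[V; V ≤ M]` uniformly in `M`
(`lintegral_lt_top_of_min_le_min`). Finally `E[y t ^ 2]` is controlled by `E[lam t ^ 2]` through the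
conditional law, and a strictly stationary square integrable sequence is weakly stationary.
-/

/-! ### Moments of the beta negative binomial law -/

/-- The beta negative binomial mass function in its natural parameters: a negative binomial law
whose success probability has the beta law with parameters `α` and `b`. The mean parametrization
of `bnbPMFReal` is the case `b = (α - 1) * lam / r`. -/
noncomputable def betaNegBin (r α b : ℝ) (k : ℕ) : ℝ :=
  Real.Gamma (k + r) / (Real.Gamma (k + 1) * Real.Gamma r) *
    (ProbabilityTheory.beta (α + r) (b + k) / ProbabilityTheory.beta α b)

theorem betaNegBin_nonneg {r α b : ℝ} (hr : 0 < r) (hα : 0 < α) (hb : 0 < b) (k : ℕ) :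
    0 ≤ betaNegBin r α b k := by
  have h1 := Real.Gamma_pos_of_pos (show (0 : ℝ) < k + r by positivity)
  have h2 := Real.Gamma_pos_of_pos (show (0 : ℝ) < k + 1 by positivity)
  have h3 := Real.Gamma_pos_of_pos hr
  have h4 := beta_pos (show 0 < α + r by positivity) (show 0 < b + k by positivity)
  have h5 := beta_pos hα hb
  unfold betaNegBin
  positivity

theorem Gamma_add_nat_eq_ascPochhammer_eval {r : ℝ} (hr : 0 < r) (k : ℕ) :
    Real.Gamma (k + r) = (ascPochhammer ℝ k).eval r * Real.Gamma r := by
  induction k with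
  | zero => simp
  | succ k ih =>
    have : ((k + 1 : ℕ) : ℝ) + r = (k + r) + 1 := by push_cast; ring
    rw [this, Real.Gamma_add_one (by positivity), ih, ascPochhammer_succ_eval]
    ring

theorem Gamma_div_Gamma_eq_choose {r : ℝ} (hr : 0 < r) (k : ℕ) :
    Real.Gamma (k + r) / (Real.Gamma (k + 1) * Real.Gamma r) = Ring.choose (r + k - 1) k := by
  have h := Ring.factorial_nsmul_multichoose_eq_ascPochhammer r k
  rw [Polynomial.ascPochhammer_smeval_eq_eval, nsmul_eq_mul, Ring.multichoose_eq] at h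
  have hf : (k.factorial : ℝ) ≠ 0 := by positivity
  have hg := (Real.Gamma_pos_of_pos hr).ne'
  rw [Gamma_add_nat_eq_ascPochhammer_eval hr, Real.Gamma_nat_eq_factorial, ← h]
  field_simp

/-- Partial sums of the negative binomial mass function with success probability `x`. -/
theorem sum_negBin_le_one {r x : ℝ} (hr : 0 < r) (hx : 0 < x) (hx1 : x < 1) (n : ℕ) :
    ∑ k ∈ Finset.range n,
      Real.Gamma (k + r) / (Real.Gamma (k + 1) * Real.Gamma r) * (x ^ r * (1 - x) ^ k) ≤ 1 := by
  have hs := (Real.one_div_one_sub_rpow_hasFPowerSeriesOnBall_zero r).hasSum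
    (y := 1 - x) (by simp [enorm_eq_nnnorm, ← NNReal.coe_lt_one, abs_of_pos (sub_pos.2 hx1), hx])
  simp only [FormalMultilinearSeries.ofScalars_apply_eq, zero_add, sub_sub_cancel,
    smul_eq_mul] at hs
  have hxr : 0 < x ^ r := Real.rpow_pos_of_pos hx r
  have h1x : 0 < 1 - x := sub_pos.2 hx1
  have hle := sum_le_hasSum (Finset.range n) (fun k _ => by
    rw [← Gamma_div_Gamma_eq_choose hr]
    have h1 := Real.Gamma_pos_of_pos (show (0 : ℝ) < k + r by positivity)
    have h2 := Real.Gamma_pos_of_pos (show (0 : ℝ) < k + 1 by positivity)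
    have h3 := Real.Gamma_pos_of_pos hr
    positivity) hs
  calc _ = x ^ r * ∑ k ∈ Finset.range n, Ring.choose (r + k - 1) k * (1 - x) ^ k := by
        rw [Finset.mul_sum]
        refine Finset.sum_congr rfl fun k _ => ?_
        rw [Gamma_div_Gamma_eq_choose hr]; ring
    _ ≤ x ^ r * (1 / x ^ r) := by gcongr
    _ = 1 := by field_simp

/-- The total mass is at most one: mix the negative binomial bound over the beta law of the success
probability. -/
theorem sum_betaNegBin_le_one {r α b : ℝ} (hr : 0 < r) (hα : 0 < α) (hb : 0 < b) (n : ℕ) :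
    ∑ k ∈ Finset.range n, betaNegBin r α b k ≤ 1 := by
  have hmeas : ∀ k : ℕ, Measurable (betaPDF (α + r) (b + k)) := fun k =>
    (measurable_betaPDFReal _ _).ennreal_ofReal
  have key : ∑ k ∈ Finset.range n, ENNReal.ofReal (betaNegBin r α b k) ≤ 1 := by
    calc ∑ k ∈ Finset.range n, ENNReal.ofReal (betaNegBin r α b k)
        = ∑ k ∈ Finset.range n, ∫⁻ x, ENNReal.ofReal (betaNegBin r α b k) *
            betaPDF (α + r) (b + k) x := by
          refine Finset.sum_congr rfl fun k _ => ?_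
          rw [lintegral_const_mul _ (hmeas k), lintegral_betaPDF_eq_one (by positivity)
            (by positivity), mul_one]
      _ = ∫⁻ x, ∑ k ∈ Finset.range n, ENNReal.ofReal (betaNegBin r α b k) *
            betaPDF (α + r) (b + k) x := by
          rw [lintegral_finsetSum]
          exact fun k _ => (hmeas k).const_mul _
      _ ≤ ∫⁻ x, betaPDF α b x := by
          refine lintegral_mono fun x => ?_
          by_cases hx : 0 < x ∧ x < 1
          · have h1x : 0 < 1 - x := sub_pos.2 hx.2
            simp only [betaPDF]
            -- `x ^ r * (1 - x) ^ k` turns the `beta (α, b)` density into an unnormalized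
            -- `beta (α + r, b + k)` density.
            have hterm : ∀ k : ℕ, betaNegBin r α b k * betaPDFReal (α + r) (b + k) x =
                betaPDFReal α b x * (Real.Gamma (k + r) / (Real.Gamma (k + 1) * Real.Gamma r) *
                  (x ^ r * (1 - x) ^ k)) := by
              intro k
              have h4 := (beta_pos (show 0 < α + r by positivity)
                (show 0 < b + k by positivity)).ne'
              have h5 := (beta_pos hα hb).ne'
              rw [betaNegBin, betaPDFReal, betaPDFReal, if_pos hx, if_pos hx,
                show α + r - 1 = (α - 1) + r by ring, show b + k - 1 = (b - 1) + k by ring,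
                Real.rpow_add hx.1, Real.rpow_add h1x, Real.rpow_natCast]
              field_simp
            rw [Finset.sum_congr rfl fun k _ => by
              rw [← ENNReal.ofReal_mul (betaNegBin_nonneg hr hα hb k), hterm k],
              ← ENNReal.ofReal_sum_of_nonneg, ← Finset.mul_sum]
            · exact ENNReal.ofReal_le_ofReal (mul_le_of_le_one_right
                (betaPDFReal_pos hx.1 hx.2 hα hb).le (sum_negBin_le_one hr hx.1 hx.2 n))
            · intro k _
              rw [← hterm k]
              exact mul_nonneg (betaNegBin_nonneg hr hα hb k)
                (betaPDFReal_pos hx.1 hx.2 (by positivity) (by positivity)).le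
          · simp [betaPDF, betaPDFReal, hx]
      _ = 1 := lintegral_betaPDF_eq_one hα hb
  rw [← ENNReal.ofReal_sum_of_nonneg fun k _ => betaNegBin_nonneg hr hα hb k] at key
  exact ENNReal.ofReal_le_one.1 key

theorem beta_sub_one_add_one {α b : ℝ} (hα : 1 < α) (hb : 0 < b) :
    ProbabilityTheory.beta (α - 1) (b + 1) = b / (α - 1) * ProbabilityTheory.beta α b := by
  have h : 0 < α - 1 := sub_pos.2 hα
  have h1 : Real.Gamma α = (α - 1) * Real.Gamma (α - 1) := by
    rw [← Real.Gamma_add_one h.ne', sub_add_cancel]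
  rw [ProbabilityTheory.beta, ProbabilityTheory.beta, h1, Real.Gamma_add_one hb.ne',
    show α - 1 + (b + 1) = α + b by ring]
  field_simp

/-- Size biasing a beta negative binomial law and subtracting one gives a beta negative binomial
law with shifted parameters; this reduces factorial moments to total masses. -/
theorem succ_mul_betaNegBin_succ {r α b : ℝ} (hr : 0 < r) (hα : 1 < α) (hb : 0 < b) (k : ℕ) :
    ((k : ℝ) + 1) * betaNegBin r α b (k + 1) =
      r * b / (α - 1) * betaNegBin (r + 1) (α - 1) (b + 1) k := by
  have h : 0 < α - 1 := sub_pos.2 hα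
  have h2 := (Real.Gamma_pos_of_pos (show (0 : ℝ) < k + 1 by positivity)).ne'
  have h3 := (Real.Gamma_pos_of_pos hr).ne'
  have h5 := (beta_pos (by linarith : 0 < α) hb).ne'
  have hk : (k : ℝ) + 1 ≠ 0 := by positivity
  rw [betaNegBin, betaNegBin, beta_sub_one_add_one hα hb, Real.Gamma_add_one hr.ne']
  push_cast
  rw [Real.Gamma_add_one hk, show α - 1 + (r + 1) = α + r by ring,
    show b + 1 + (k : ℝ) = b + (k + 1) by ring, show (k : ℝ) + (r + 1) = k + 1 + r by ring]
  field_simp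

theorem sum_mul_betaNegBin_le {r α b : ℝ} (hr : 0 < r) (hα : 1 < α) (hb : 0 < b) (n : ℕ) :
    ∑ k ∈ Finset.range n, (k : ℝ) * betaNegBin r α b k ≤ r * b / (α - 1) := by
  have h : 0 < α - 1 := sub_pos.2 hα
  cases n with
  | zero => simp; positivity
  | succ n =>
    rw [Finset.sum_range_succ']
    push_cast
    simp only [succ_mul_betaNegBin_succ hr hα hb, zero_mul, add_zero, ← Finset.mul_sum]
    exact mul_le_of_le_one_right (by positivity)
      (sum_betaNegBin_le_one (by positivity) h (by positivity) n)

theorem sum_mul_sub_one_mul_betaNegBin_le {r α b : ℝ} (hr : 0 < r) (hα : 2 < α) (hb : 0 < b)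
    (n : ℕ) :
    ∑ k ∈ Finset.range n, (k : ℝ) * (k - 1) * betaNegBin r α b k ≤
      r * b / (α - 1) * ((r + 1) * (b + 1) / (α - 2)) := by
  have h : 0 < α - 1 := by linarith
  have h' : 0 < α - 2 := by linarith
  cases n with
  | zero => simp; positivity
  | succ n =>
    rw [Finset.sum_range_succ']
    have : ∀ k : ℕ, ((k + 1 : ℕ) : ℝ) * (((k + 1 : ℕ) : ℝ) - 1) * betaNegBin r α b (k + 1) =
        r * b / (α - 1) * (k * betaNegBin (r + 1) (α - 1) (b + 1) k) := by
      intro k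
      have := succ_mul_betaNegBin_succ hr (by linarith : 1 < α) hb k
      push_cast
      linear_combination (k : ℝ) * this
    simp only [this, Nat.cast_zero, zero_mul, add_zero, ← Finset.mul_sum]
    have h2 := sum_mul_betaNegBin_le (r := r + 1) (α := α - 1) (b := b + 1) (by positivity)
      (by linarith) (by positivity) n
    rw [show α - 1 - 1 = α - 2 by ring] at h2
    gcongr

theorem bnbPMFReal_nonneg {x r α : ℝ} (hr : 0 < r) (hα : 1 < α) (hx : 0 < x) (k : ℕ) :
    0 ≤ bnbPMFReal x r α k :=
  betaNegBin_nonneg hr (by linarith) (by have := sub_pos.2 hα; positivity) k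

theorem tsum_bnbPMFReal_le_one {x r α : ℝ} (hr : 0 < r) (hα : 1 < α) (hx : 0 < x) :
    ∑' k : ℕ, ENNReal.ofReal (bnbPMFReal x r α k) ≤ 1 := by
  refine ENNReal.tsum_le_of_sum_range_le fun n => ?_
  rw [← ENNReal.ofReal_sum_of_nonneg fun k _ => bnbPMFReal_nonneg hr hα hx k]
  exact ENNReal.ofReal_le_one.2 (sum_betaNegBin_le_one hr (by linarith)
    (by have := sub_pos.2 hα; positivity) n)

/-- Expectation bound for a nonnegative quadratic, written in factorial powers, under the beta
negative binomial law with mean `x`. -/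
theorem tsum_bnbPMFReal_mul_quadratic_le {x r α : ℝ} (hr : 0 < r) (hα : 2 < α) (hx : 0 < x)
    {u v w : ℝ} (hu : 0 ≤ u) (hv : 0 ≤ v) (hw : 0 ≤ w) {Q : ℕ → ℝ}
    (hQ : ∀ k : ℕ, Q k = u * (k * (k - 1)) + v * k + w) (hQ0 : ∀ k, 0 ≤ Q k) :
    ∑' k : ℕ, ENNReal.ofReal (bnbPMFReal x r α k) * ENNReal.ofReal (Q k) ≤
      ENNReal.ofReal (u * ((r + 1) * (α - 1) / (r * (α - 2)) * x ^ 2 + (r + 1) / (α - 2) * x)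
        + v * x + w) := by
  have h1 : 0 < α - 1 := by linarith
  have h2 : 0 < α - 2 := by linarith
  have hb : 0 < (α - 1) * x / r := by positivity
  refine ENNReal.tsum_le_of_sum_range_le fun n => ?_
  have hnn := bnbPMFReal_nonneg hr (by linarith : 1 < α) hx
  simp_rw [← ENNReal.ofReal_mul (hnn _)]
  rw [← ENNReal.ofReal_sum_of_nonneg fun k _ => mul_nonneg (hnn k) (hQ0 k)]
  refine ENNReal.ofReal_le_ofReal ?_
  have m0 := sum_betaNegBin_le_one hr (by linarith : 0 < α) hb n
  have m1 := sum_mul_betaNegBin_le hr (by linarith : 1 < α) hb n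
  have m2 := sum_mul_sub_one_mul_betaNegBin_le hr hα hb n
  have e1 : r * ((α - 1) * x / r) / (α - 1) = x := by field_simp
  have e2 : x * ((r + 1) * ((α - 1) * x / r + 1) / (α - 2)) =
      (r + 1) * (α - 1) / (r * (α - 2)) * x ^ 2 + (r + 1) / (α - 2) * x := by
    field_simp
  rw [e1] at m1 m2
  rw [e2] at m2
  have hsplit : ∑ k ∈ Finset.range n, bnbPMFReal x r α k * Q k =
      u * ∑ k ∈ Finset.range n, (k : ℝ) * (k - 1) * betaNegBin r α ((α - 1) * x / r) k +
      v * ∑ k ∈ Finset.range n, (k : ℝ) * betaNegBin r α ((α - 1) * x / r) k +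
      w * ∑ k ∈ Finset.range n, betaNegBin r α ((α - 1) * x / r) k := by
    rw [Finset.mul_sum, Finset.mul_sum, Finset.mul_sum, ← Finset.sum_add_distrib,
      ← Finset.sum_add_distrib]
    refine Finset.sum_congr rfl fun k _ => ?_
    rw [hQ k, show bnbPMFReal x r α k = betaNegBin r α ((α - 1) * x / r) k from rfl]
    ring
  rw [hsplit]
  have := mul_le_mul_of_nonneg_left m2 hu
  have := mul_le_mul_of_nonneg_left m1 hv
  have := mul_le_mul_of_nonneg_left m0 hw
  linarith

/-- Conditional second moment of the linear bound `c₁ * y + c₂ * x + K` on the next intensity: the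
coefficient of `x ^ 2` is the constant of the contraction hypothesis. -/
theorem tsum_bnbPMFReal_mul_sq_le {r α c₁ c₂ K x : ℝ} (hr : 0 < r) (hα : 2 < α) (hc₁ : 0 ≤ c₁)
    (hc₂ : 0 ≤ c₂) (hK : 0 ≤ K) (hx : 0 < x) :
    ∑' k : ℕ, ENNReal.ofReal (bnbPMFReal x r α k) *
        ENNReal.ofReal ((c₁ * k + c₂ * x + K) ^ 2) ≤
      ENNReal.ofReal (((r + 1) * (α - 1) / (r * (α - 2)) * c₁ ^ 2 + c₂ ^ 2 + 2 * c₁ * c₂) * x ^ 2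
        + (c₁ ^ 2 * ((r + 1) / (α - 2)) + c₁ ^ 2 + 2 * c₁ * K + 2 * c₂ * K) * x + K ^ 2) := by
  refine (tsum_bnbPMFReal_mul_quadratic_le hr hα hx (u := c₁ ^ 2)
    (v := c₁ ^ 2 + 2 * c₁ * (c₂ * x + K)) (w := (c₂ * x + K) ^ 2) (by positivity) (by positivity)
    (by positivity) (fun k => by ring) fun k => by positivity).trans (le_of_eq ?_)
  congr 1
  ring

/-! ### Integration against the conditional law -/

theorem pastSigma_le {Ω : Type*} [mΩ : MeasurableSpace Ω] {y : ℤ → Ω → ℕ}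
    (hy : ∀ t, Measurable (y t)) (t : ℤ) : pastSigma y t ≤ mΩ :=
  iSup_le fun s => (hy s).comap_le

/-- If `A` has conditional probability `p` given `m`, integrating a bounded nonnegative
`m`-measurable function over `A` amounts to weighting it by `p`. -/
theorem lintegral_indicator_mul_eq_of_condExp {Ω : Type*} {m mΩ : MeasurableSpace Ω}
    {μ : Measure Ω} [IsProbabilityMeasure μ] (hm : m ≤ mΩ) {A : Set Ω} (hA : MeasurableSet A)
    {p f : Ω → ℝ} (hp : μ[A.indicator (fun _ => (1 : ℝ)) | m] =ᵐ[μ] p) (hp0 : 0 ≤ᵐ[μ] p)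
    (hf : AEStronglyMeasurable[m] f μ) (hf0 : 0 ≤ᵐ[μ] f) {M : ℝ} (hfM : ∀ᵐ ω ∂μ, f ω ≤ M) :
    ∫⁻ ω, A.indicator (fun ω => ENNReal.ofReal (f ω)) ω ∂μ =
      ∫⁻ ω, ENNReal.ofReal (p ω) * ENNReal.ofReal (f ω) ∂μ := by
  have hI : Integrable (A.indicator (fun _ => (1 : ℝ))) μ :=
    (integrable_const 1).indicator hA
  have hbound : ∀ᵐ ω ∂μ, ‖f ω‖ ≤ M := by
    filter_upwards [hf0, hfM] with ω h0 h1
    rwa [Real.norm_of_nonneg h0]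
  have hIf : Integrable (A.indicator (fun _ => (1 : ℝ)) * f) μ :=
    hI.mul_bdd (c := M) (hf.mono hm) hbound
  have hpull := condExp_mul_of_aestronglyMeasurable_right hf hIf hI
  have hpf : μ[A.indicator (fun _ => (1 : ℝ)) * f | m] =ᵐ[μ] fun ω => p ω * f ω := by
    filter_upwards [hpull, hp] with ω h1 h2
    rw [h1, Pi.mul_apply, h2]
  have hpi : Integrable (fun ω => p ω * f ω) μ := integrable_condExp.congr hpf
  have hint : ∫ ω, (A.indicator (fun _ => (1 : ℝ)) * f) ω ∂μ = ∫ ω, p ω * f ω ∂μ := by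
    rw [← integral_condExp hm]
    exact integral_congr_ae hpf
  have e1 : ∫⁻ ω, A.indicator (fun ω => ENNReal.ofReal (f ω)) ω ∂μ =
      ∫⁻ ω, ENNReal.ofReal ((A.indicator (fun _ => (1 : ℝ)) * f) ω) ∂μ := by
    refine lintegral_congr fun ω => ?_
    by_cases h : ω ∈ A <;> simp [h]
  have e2 : ∫⁻ ω, ENNReal.ofReal (p ω) * ENNReal.ofReal (f ω) ∂μ =
      ∫⁻ ω, ENNReal.ofReal (p ω * f ω) ∂μ := by
    refine lintegral_congr_ae ?_
    filter_upwards [hp0] with ω h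
    rw [ENNReal.ofReal_mul h]
  rw [e1, e2, ← ofReal_integral_eq_lintegral_ofReal hIf, hint,
    ofReal_integral_eq_lintegral_ofReal hpi]
  · filter_upwards [hp0, hf0] with ω h1 h2 using mul_nonneg h1 h2
  · filter_upwards [hf0] with ω h2
    exact mul_nonneg (Set.indicator_nonneg (fun _ _ => zero_le_one) _) h2

/-- A bound `R` on conditional expectations of `Q` survives truncation at any level `M`: no
integrability is needed for the truncated inequality. -/
theorem IsBNBAutoregression.lintegral_min_le {Ω : Type*} [MeasurableSpace Ω] {μ : Measure Ω}
    [IsProbabilityMeasure μ] {r α : ℝ} (hr : 0 < r) (hα : 2 < α) {g : ℕ → ℝ → ℝ}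
    {y : ℤ → Ω → ℕ} {lam : ℤ → Ω → ℝ} (hsol : IsBNBAutoregression μ r α g y lam)
    {Q : ℕ → ℝ → ℝ} {R : ℝ → ℝ} (hQm : ∀ k, Measurable (Q k)) (hQ0 : ∀ k x, 0 ≤ Q k x)
    (hQR : ∀ x, 0 < x → ∑' k : ℕ, ENNReal.ofReal (bnbPMFReal x r α k) * ENNReal.ofReal (Q k x) ≤
      ENNReal.ofReal (R x)) {M : ℝ} (hM : 0 ≤ M) (t : ℤ) :
    ∫⁻ ω, ENNReal.ofReal (min (Q (y t ω) (lam t ω)) M) ∂μ ≤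
      ∫⁻ ω, ENNReal.ofReal (min (R (lam t ω)) M) ∂μ := by
  have hm := pastSigma_le hsol.measurable_count (t - 1)
  have hlam := (hsol.predictable t).mono hm
  have hset : ∀ k : ℕ, MeasurableSet (y t ⁻¹' {k}) := fun k =>
    hsol.measurable_count t (measurableSet_singleton k)
  have hfm : ∀ k : ℕ, Measurable fun x => min (Q k x) M := fun k =>
    (hQm k).min measurable_const
  have hfo : ∀ k : ℕ, AEMeasurable (fun ω => ENNReal.ofReal (min (Q k (lam t ω)) M)) μ :=
    fun k => ((hfm k).comp_aemeasurable hlam.aemeasurable).ennreal_ofReal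
  have hpm : ∀ k : ℕ, AEMeasurable (fun ω => ENNReal.ofReal (bnbPMFReal (lam t ω) r α k)) μ := by
    intro k
    refine AEMeasurable.ennreal_ofReal ?_
    exact (stronglyMeasurable_condExp.mono hm).measurable.aemeasurable.congr (hsol.condLaw t k)
  calc ∫⁻ ω, ENNReal.ofReal (min (Q (y t ω) (lam t ω)) M) ∂μ
      = ∫⁻ ω, ∑' k : ℕ, (y t ⁻¹' {k}).indicator
          (fun ω => ENNReal.ofReal (min (Q k (lam t ω)) M)) ω ∂μ := by
        refine lintegral_congr fun ω => ?_
        rw [tsum_eq_single (y t ω)]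
        · simp
        · intro k hk
          simp [hk.symm]
    _ = ∑' k : ℕ, ∫⁻ ω, (y t ⁻¹' {k}).indicator
          (fun ω => ENNReal.ofReal (min (Q k (lam t ω)) M)) ω ∂μ :=
        lintegral_tsum fun k => (hfo k).indicator (hset k)
    _ = ∑' k : ℕ, ∫⁻ ω, ENNReal.ofReal (bnbPMFReal (lam t ω) r α k) *
          ENNReal.ofReal (min (Q k (lam t ω)) M) ∂μ := by
        refine tsum_congr fun k => ?_
        refine lintegral_indicator_mul_eq_of_condExp hm (hset k) (hsol.condLaw t k) ?_ ?_ ?_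
          (M := M) ?_
        · filter_upwards [hsol.pos t] with ω h using bnbPMFReal_nonneg hr (by linarith) h k
        · obtain ⟨l, hl, hle⟩ := hsol.predictable t
          exact ⟨fun ω => min (Q k (l ω)) M, ((hfm k).comp hl.measurable).stronglyMeasurable,
            hle.mono fun ω h => by simp only [h]⟩
        · exact .of_forall fun ω => le_min (hQ0 _ _) hM
        · exact .of_forall fun ω => min_le_right _ _
    _ = ∫⁻ ω, ∑' k : ℕ, ENNReal.ofReal (bnbPMFReal (lam t ω) r α k) *
          ENNReal.ofReal (min (Q k (lam t ω)) M) ∂μ :=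
        (lintegral_tsum fun k => (hpm k).mul (hfo k)).symm
    _ ≤ ∫⁻ ω, ENNReal.ofReal (min (R (lam t ω)) M) ∂μ := by
        refine lintegral_mono_ae ?_
        filter_upwards [hsol.pos t] with ω h
        rw [ENNReal.ofReal_min]
        refine le_min ((ENNReal.tsum_le_tsum fun k => ?_).trans (hQR _ h)) ?_
        · gcongr
          exact min_le_left _ _
        · calc _ ≤ ∑' k : ℕ, ENNReal.ofReal (bnbPMFReal (lam t ω) r α k) * ENNReal.ofReal M :=
                ENNReal.tsum_le_tsum fun k => by gcongr; exact min_le_right _ _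
            _ ≤ 1 * ENNReal.ofReal M := by
                rw [ENNReal.tsum_mul_right]
                gcongr
                exact tsum_bnbPMFReal_le_one hr (by linarith) h
            _ = _ := one_mul _

/-! ### Moments from a truncated drift inequality -/

theorem lintegral_le_of_eventually_eq {Ω : Type*} [MeasurableSpace Ω] {μ : Measure Ω}
    {f : ℕ → Ω → ENNReal} {F : Ω → ENNReal} {D : ENNReal} (hf : ∀ n, AEMeasurable (f n) μ)
    (h : ∀ ω, ∀ᶠ n in Filter.atTop, f n ω = F ω) (hD : ∀ n, ∫⁻ ω, f n ω ∂μ ≤ D) :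
    ∫⁻ ω, F ω ∂μ ≤ D := by
  have hlim : ∀ ω, Filter.liminf (fun n => f n ω) Filter.atTop = F ω := fun ω =>
    (tendsto_const_nhds.congr' ((h ω).mono fun _ hn => hn.symm)).liminf_eq
  have hfatou := lintegral_liminf_le' (u := Filter.atTop) hf
  simp only [hlim] at hfatou
  refine hfatou.trans (Filter.liminf_le_of_le (by isBoundedDefault) fun b hb => ?_)
  obtain ⟨n, hn⟩ := hb.exists
  exact hn.trans (hD n)

/-- If a nonnegative variable satisfies the drift inequality `E[X ∧ M] ≤ E[(κ X + C) ∧ M]` with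
`κ < 1` at every truncation level, it is integrable. -/
theorem lintegral_lt_top_of_min_le_min {Ω : Type*} [MeasurableSpace Ω] {μ : Measure Ω}
    [IsProbabilityMeasure μ] {X : Ω → ℝ} (hX : AEMeasurable X μ) (hX0 : ∀ ω, 0 ≤ X ω)
    {κ C : ℝ} (hκ0 : 0 ≤ κ) (hκ : κ < 1) (hC : 0 ≤ C)
    (h : ∀ n : ℕ, ∫⁻ ω, ENNReal.ofReal (min (X ω) n) ∂μ ≤
      ∫⁻ ω, ENNReal.ofReal (min (κ * X ω + C) n) ∂μ) :
    ∫⁻ ω, ENNReal.ofReal (X ω) ∂μ < ⊤ := by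
  have h1κ : 0 < 1 - κ := sub_pos.2 hκ
  have hmS : ∀ n : ℕ, NullMeasurableSet {ω | X ω ≤ n} μ := fun n =>
    nullMeasurableSet_le hX aemeasurable_const
  have hmI : ∀ n : ℕ, AEMeasurable
      ({ω | X ω ≤ n}.indicator fun ω => ENNReal.ofReal ((1 - κ) * X ω)) μ := fun n =>
    (hX.const_mul (1 - κ)).ennreal_ofReal.indicator₀ (hmS n)
  have hmR : ∀ n : ℕ, AEMeasurable (fun ω => ENNReal.ofReal (min (κ * X ω + C) n)) μ := fun n =>
    (((hX.const_mul κ).add_const C).min aemeasurable_const).ennreal_ofReal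
  have hbdd : ∀ n : ℕ, ∫⁻ ω, ({ω | X ω ≤ n}.indicator
      fun ω => ENNReal.ofReal ((1 - κ) * X ω)) ω ∂μ ≤ ENNReal.ofReal C := by
    intro n
    have hfin : ∫⁻ ω, ENNReal.ofReal (min (κ * X ω + C) n) ∂μ ≠ ⊤ := by
      refine ne_top_of_le_ne_top (b := ENNReal.ofReal n) ENNReal.ofReal_ne_top ?_
      calc _ ≤ ∫⁻ _, ENNReal.ofReal n ∂μ :=
            lintegral_mono fun ω => ENNReal.ofReal_le_ofReal (min_le_right _ _)
        _ = _ := by simp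
    refine (ENNReal.add_le_add_iff_right hfin).1 ?_
    rw [← lintegral_add_right' _ (hmR n)]
    calc _ ≤ ∫⁻ ω, (ENNReal.ofReal C + ENNReal.ofReal (min (X ω) n)) ∂μ := by
          refine lintegral_mono fun ω => ?_
          have hx := hX0 ω
          have hn : (0 : ℝ) ≤ n := n.cast_nonneg
          have hmin : 0 ≤ min (κ * X ω + C) n := le_min (by positivity) hn
          by_cases hle : X ω ≤ n
          · simp only [Set.indicator, Set.mem_ofPred_eq, hle, if_true]
            rw [← ENNReal.ofReal_add (by positivity) hmin,
              ← ENNReal.ofReal_add hC (le_min hx hn)]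
            refine ENNReal.ofReal_le_ofReal ?_
            rw [min_eq_left hle]
            linarith [min_le_left (κ * X ω + C) (n : ℝ)]
          · simp only [Set.indicator, Set.mem_ofPred_eq, hle, if_false, zero_add]
            rw [min_eq_right (not_le.1 hle).le]
            exact (ENNReal.ofReal_le_ofReal (min_le_right _ _)).trans le_add_self
      _ = ENNReal.ofReal C + ∫⁻ ω, ENNReal.ofReal (min (X ω) n) ∂μ := by
          rw [lintegral_add_left measurable_const]
          simp
      _ ≤ _ := add_le_add le_rfl (h n)
  have hle : ∫⁻ ω, ENNReal.ofReal ((1 - κ) * X ω) ∂μ ≤ ENNReal.ofReal C := by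
    refine lintegral_le_of_eventually_eq hmI (fun ω => ?_) hbdd
    obtain ⟨N, hN⟩ := exists_nat_ge (X ω)
    filter_upwards [Filter.eventually_ge_atTop N] with n hn
    have : X ω ≤ n := hN.trans (by exact_mod_cast hn)
    simp [this]
  simp only [ENNReal.ofReal_mul h1κ.le] at hle
  rw [lintegral_const_mul' _ _ ENNReal.ofReal_ne_top] at hle
  refine lt_top_iff_ne_top.2 fun htop => ?_
  rw [htop, ENNReal.mul_top (ENNReal.ofReal_pos.2 h1κ).ne'] at hle
  exact ENNReal.ofReal_ne_top (top_le_iff.1 hle)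

/-! ### Strict and weak stationarity -/

theorem IsStrictlyStationary.identDistrib {Ω S : Type*} [MeasurableSpace Ω] [MeasurableSpace S]
    {μ : Measure Ω} {X : ℤ → Ω → S} (h : IsStrictlyStationary μ X) (s t : ℤ) :
    IdentDistrib (X s) (X t) μ μ := by
  have := (h (s - t)).comp (measurable_pi_apply t)
  simpa [Function.comp_def] using this

theorem IsStrictlyStationary.comp {Ω S T : Type*} [MeasurableSpace Ω] [MeasurableSpace S]
    [MeasurableSpace T] {μ : Measure Ω} {X : ℤ → Ω → S} (h : IsStrictlyStationary μ X)
    {f : S → T} (hf : Measurable f) : IsStrictlyStationary μ fun t ω => f (X t ω) := fun k =>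
  (h k).comp (u := fun x : ℤ → S => fun t => f (x t))
    (measurable_pi_lambda _ fun t => hf.comp (measurable_pi_apply t))

theorem IsStrictlyStationary.isWeaklyStationary {Ω : Type*} [MeasurableSpace Ω]
    {μ : Measure Ω} {X : ℤ → Ω → ℝ} (h : IsStrictlyStationary μ X) (hX : ∀ t, MemLp (X t) 2 μ) :
    IsWeaklyStationary μ X where
  memLp := hX
  mean_eq s t := (h.identDistrib s t).integral_eq
  cov_eq s t k := by
    have hpath := h k
    have h1 : ∀ u, AEStronglyMeasurable (fun x : ℤ → ℝ => x u)
        (μ.map fun ω t => X (t + k) ω) := fun u =>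
      (measurable_pi_apply u).aestronglyMeasurable
    have h2 : ∀ u, AEStronglyMeasurable (fun x : ℤ → ℝ => x u) (μ.map fun ω t => X t ω) := fun u =>
      (measurable_pi_apply u).aestronglyMeasurable
    have e1 := covariance_map_fun (h1 s) (h1 t) hpath.aemeasurable_fst
    have e2 := covariance_map_fun (h2 s) (h2 t) hpath.aemeasurable_snd
    rw [hpath.map_eq] at e1
    exact e1.symm.trans e2

/-! ### Second moments of the stationary solution -/

/-- Lipschitz continuity gives linear growth of the intensity. -/
theorem IsBNBAutoregression.exists_intensity_succ_le {Ω : Type*} [MeasurableSpace Ω]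
    {μ : Measure Ω} {r α c₁ c₂ : ℝ} (hc₂ : 0 ≤ c₂) {g : ℕ → ℝ → ℝ}
    (hg : ∀ (k : ℕ) (x : ℝ), 0 < x → 0 < g k x)
    (hcontr : ∀ (k k' : ℕ) (x x' : ℝ), 0 < x → 0 < x' →
      |g k x - g k' x'| ≤ c₁ * |(k : ℝ) - (k' : ℝ)| + c₂ * |x - x'|)
    {y : ℤ → Ω → ℕ} {lam : ℤ → Ω → ℝ} (hsol : IsBNBAutoregression μ r α g y lam) :
    ∃ K, 0 ≤ K ∧ ∀ t, ∀ᵐ ω ∂μ, lam (t + 1) ω ≤ c₁ * y t ω + c₂ * lam t ω + K := by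
  refine ⟨g 0 1 + c₂, add_nonneg (hg 0 1 one_pos).le hc₂, fun t => ?_⟩
  filter_upwards [hsol.pos t, hsol.recursion t] with ω hpos hrec
  have h := (le_abs_self _).trans (hcontr (y t ω) 0 (lam t ω) 1 hpos one_pos)
  have h1 : |lam t ω - 1| ≤ lam t ω + 1 := abs_le.2 ⟨by linarith, by linarith⟩
  rw [Nat.cast_zero, sub_zero, Nat.abs_cast] at h
  rw [hrec]
  linarith [mul_le_mul_of_nonneg_left h1 hc₂]

/-- The stationary intensity is square integrable. -/
theorem IsBNBAutoregression.lintegral_sq_intensity_lt_top {Ω : Type*} [MeasurableSpace Ω]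
    {μ : Measure Ω} [IsProbabilityMeasure μ]
    {r α c₁ c₂ : ℝ} (hr : 0 < r) (hα : 2 < α) (hc₁ : 0 ≤ c₁) (hc₂ : 0 ≤ c₂)
    {g : ℕ → ℝ → ℝ} (hg : ∀ (k : ℕ) (x : ℝ), 0 < x → 0 < g k x)
    (hcontr : ∀ (k k' : ℕ) (x x' : ℝ), 0 < x → 0 < x' →
      |g k x - g k' x'| ≤ c₁ * |(k : ℝ) - (k' : ℝ)| + c₂ * |x - x'|)
    (hc : (r + 1) * (α - 1) / (r * (α - 2)) * c₁ ^ 2 + c₂ ^ 2 + 2 * c₁ * c₂ < 1)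
    {y : ℤ → Ω → ℕ} {lam : ℤ → Ω → ℝ} (hsol : IsBNBAutoregression μ r α g y lam)
    (hstat : IsStrictlyStationary μ lam) (t : ℤ) :
    ∫⁻ ω, ENNReal.ofReal (lam t ω ^ 2) ∂μ < ⊤ := by
  obtain ⟨K, hK, hgrow⟩ := hsol.exists_intensity_succ_le hc₂ hg hcontr
  have h1 : 0 < α - 1 := by linarith
  have h2 : 0 < α - 2 := by linarith
  set κ := (r + 1) * (α - 1) / (r * (α - 2)) * c₁ ^ 2 + c₂ ^ 2 + 2 * c₁ * c₂ with hκdef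
  set L := c₁ ^ 2 * ((r + 1) / (α - 2)) + c₁ ^ 2 + 2 * c₁ * K + 2 * c₂ * K with hLdef
  have hκ0 : 0 ≤ κ := by positivity
  have hδ : 0 < 1 - κ := sub_pos.2 hc
  -- The linear term is absorbed into half of the gap `1 - κ` by Young's inequality.
  have hyoung : ∀ x : ℝ, κ * x ^ 2 + L * x + K ^ 2 ≤
      (κ + 1) / 2 * x ^ 2 + (K ^ 2 + L ^ 2 / (2 * (1 - κ))) := by
    intro x
    have e : (κ + 1) / 2 * x ^ 2 + (K ^ 2 + L ^ 2 / (2 * (1 - κ))) -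
        (κ * x ^ 2 + L * x + K ^ 2) = ((1 - κ) * x - L) ^ 2 / (2 * (1 - κ)) := by
      field_simp
      ring
    have : 0 ≤ ((1 - κ) * x - L) ^ 2 / (2 * (1 - κ)) := by positivity
    linarith
  have hlam : AEMeasurable (lam t) μ := (hstat.identDistrib t t).aemeasurable_fst
  refine lintegral_lt_top_of_min_le_min (hlam.pow_const 2) (fun ω => sq_nonneg _)
    (κ := (κ + 1) / 2) (C := K ^ 2 + L ^ 2 / (2 * (1 - κ))) (by positivity) (by linarith)
    (by positivity) fun n => ?_
  calc ∫⁻ ω, ENNReal.ofReal (min (lam t ω ^ 2) n) ∂μ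
      = ∫⁻ ω, ENNReal.ofReal (min (lam (t + 1) ω ^ 2) n) ∂μ :=
        ((hstat.identDistrib t (t + 1)).comp (u := fun x => ENNReal.ofReal (min (x ^ 2) n))
          (by fun_prop)).lintegral_eq
    _ ≤ ∫⁻ ω, ENNReal.ofReal (min ((c₁ * y t ω + c₂ * lam t ω + K) ^ 2) n) ∂μ := by
        refine lintegral_mono_ae ?_
        filter_upwards [hgrow t, hsol.pos (t + 1)] with ω h hpos
        gcongr
    _ ≤ ∫⁻ ω, ENNReal.ofReal (min (κ * lam t ω ^ 2 + L * lam t ω + K ^ 2) n) ∂μ :=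
        hsol.lintegral_min_le hr hα (Q := fun k x => (c₁ * k + c₂ * x + K) ^ 2)
          (R := fun x => κ * x ^ 2 + L * x + K ^ 2) (fun k => by fun_prop)
          (fun k x => sq_nonneg _)
          (fun x hx => tsum_bnbPMFReal_mul_sq_le hr hα hc₁ hc₂ hK hx) n.cast_nonneg t
    _ ≤ _ := lintegral_mono fun ω => ENNReal.ofReal_le_ofReal (min_le_min_right _ (hyoung _))

theorem IsBNBAutoregression.integrable_sq_count {Ω : Type*} [MeasurableSpace Ω]
    {μ : Measure Ω} [IsProbabilityMeasure μ] {r α : ℝ} (hr : 0 < r) (hα : 2 < α)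
    {g : ℕ → ℝ → ℝ} {y : ℤ → Ω → ℕ} {lam : ℤ → Ω → ℝ}
    (hsol : IsBNBAutoregression μ r α g y lam) {t : ℤ}
    (hlam : ∫⁻ ω, ENNReal.ofReal (lam t ω ^ 2) ∂μ < ⊤) :
    Integrable (fun ω => (y t ω : ℝ) ^ 2) μ := by
  have h1 : 0 < α - 1 := by linarith
  have h2 : 0 < α - 2 := by linarith
  have hym : Measurable fun ω => (y t ω : ℝ) ^ 2 :=
    (measurable_from_top.comp (hsol.measurable_count t)).pow_const 2
  set A := (r + 1) * (α - 1) / (r * (α - 2)) with hA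
  set B := (r + 1) / (α - 2) + 1 with hB
  have hA0 : 0 ≤ A := by positivity
  have hB0 : 0 ≤ B := by positivity
  have hbd : ∫⁻ ω, ENNReal.ofReal ((y t ω : ℝ) ^ 2) ∂μ ≤
      ∫⁻ ω, (ENNReal.ofReal (A + B) * ENNReal.ofReal (lam t ω ^ 2) + ENNReal.ofReal B) ∂μ := by
    refine lintegral_le_of_eventually_eq
      (f := fun (n : ℕ) ω => ENNReal.ofReal (min ((y t ω : ℝ) ^ 2) n))
      (fun n => (hym.min measurable_const).ennreal_ofReal.aemeasurable) (fun ω => ?_) fun n => ?_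
    · filter_upwards [Filter.eventually_ge_atTop (y t ω ^ 2)] with n hn
      rw [min_eq_left (by exact_mod_cast hn)]
    · refine (hsol.lintegral_min_le hr hα (Q := fun k _ => (k : ℝ) ^ 2)
        (R := fun x => (A + B) * x ^ 2 + B) (fun k => measurable_const)
        (fun k x => sq_nonneg _) (fun x hx => ?_) n.cast_nonneg t).trans
        (lintegral_mono fun ω => ?_)
      · refine (tsum_bnbPMFReal_mul_quadratic_le hr hα hx (u := 1) (v := 1) (w := 0) zero_le_one
          zero_le_one le_rfl (fun k => by ring) fun k => by positivity).trans
          (ENNReal.ofReal_le_ofReal ?_)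
        have : B * x ≤ B * (x ^ 2 + 1) := by
          gcongr
          nlinarith [sq_nonneg (x - 1)]
        linarith
      · rw [← ENNReal.ofReal_mul (by positivity), ← ENNReal.ofReal_add (by positivity) hB0]
        exact ENNReal.ofReal_le_ofReal (min_le_left _ _)
  refine ⟨hym.aestronglyMeasurable, ?_⟩
  rw [hasFiniteIntegral_iff_ofReal (.of_forall fun ω => sq_nonneg _)]
  refine hbd.trans_lt ?_
  rw [lintegral_add_right _ measurable_const, lintegral_const_mul' _ _ ENNReal.ofReal_ne_top]
  simpa using ENNReal.mul_lt_top ENNReal.ofReal_lt_top hlam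

theorem theorem2 {Ω : Type*} [MeasurableSpace Ω] (μ : Measure Ω) [IsProbabilityMeasure μ]
    (r α c₁ c₂ : ℝ) (hr : 0 < r) (hα : 2 < α) (hc₁ : 0 ≤ c₁) (hc₂ : 0 ≤ c₂)
    (g : ℕ → ℝ → ℝ) (hg : ∀ (k : ℕ) (x : ℝ), 0 < x → 0 < g k x)
    (hcontr : ∀ (k k' : ℕ) (x x' : ℝ), 0 < x → 0 < x' →
      |g k x - g k' x'| ≤ c₁ * |(k : ℝ) - (k' : ℝ)| + c₂ * |x - x'|)
    (hc : (r + 1) * (α - 1) / (r * (α - 2)) * c₁ ^ 2 + c₂ ^ 2 + 2 * c₁ * c₂ < 1)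
    (y : ℤ → Ω → ℕ) (lam : ℤ → Ω → ℝ)
    (hsol : IsBNBAutoregression μ r α g y lam)
    (hstat : IsStrictlyStationary μ (fun t ω => (y t ω, lam t ω))) :
    (∀ t : ℤ, Integrable (fun ω => (y t ω : ℝ) ^ 2) μ) ∧
      IsWeaklyStationary μ (fun t ω => (y t ω : ℝ)) := by
  have hint : ∀ t : ℤ, Integrable (fun ω => (y t ω : ℝ) ^ 2) μ := fun t =>
    hsol.integrable_sq_count hr hα (hsol.lintegral_sq_intensity_lt_top hr hα hc₁ hc₂ hg hcontr hc
      (hstat.comp measurable_snd) t)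
  have hcast : Measurable fun p : ℕ × ℝ => (p.1 : ℝ) := measurable_from_top.comp measurable_fst
  refine ⟨hint, (hstat.comp hcast).isWeaklyStationary fun t => ?_⟩
  exact (memLp_two_iff_integrable_sq
    (measurable_from_top.comp (hsol.measurable_count t)).aestronglyMeasurable).2 (hint t)
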